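/- Theorem 4.4. Let $\Gamma=(V,E,s,r)$ be a row-finite directed graph, i.e. $V$ and $E$ are sets (vertices and edges), $s,r\colon E\to V$ are maps (source and range), and $s^{-1}(v)$ is finite for every $v\in V$. Let $\mathbf B=\{0,1\}$ be the Boolean semifield ($1+1=1$), and let the Leavitt path algebra $L_{\mathbf B}(\Gamma)$ be the (not necessarily unital) associative $\mathbf B$-algebra presented by the generators $v\in V$, $e\in E$ and $e^*$ ($e\in E$), and the relations (i) $vv'=\delta_{v,v'}v$ for all $v,v'\in V$; (ii) $s(e)e=e=e\,r(e)$ and $r(e)e^*=e^*=e^*s(e)$ for all $e\in E$; (iii) $e^*f=\delta_{e,f}\,r(e)$ for all $e,f\in E$; (iv) $v=\sum_{e\in s^{-1}(v)}ee^*$ for every regular vertex $v$, i.e. every $v\in V$ such that $s^{-1}(v)$ is nonempty and finite. Then $L_{\mathbf B}(\Gamma)$ is congruence-simple (that is, the diagonal and the universal congruence are the only equivalence relations on it that are compatible with addition and with multiplication) if and only if the following two conditions hold: (1) The only hereditary and saturated subsets of $V$ are $\varnothing$ and $V$. Here $H\subseteq V$ is hereditary if $s(e)\in H$ implies $r(e)\in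 H$ for all $e\in E$, and saturated if every regular vertex $v$ with $r(s^{-1}(v))\subseteq H$ lies in $H$. (2) Every cycle in $\Gamma$ has an exit. Here a cycle is a sequence of edges $e_1,\dots,e_n$ ($n\ge1$) with $r(e_i)=s(e_{i+1})$ for $1\le i<n$, with $r(e_n)=s(e_1)$, and with $s(e_1),\dots,s(e_n)$ distinct; an exit for it is an edge $f$ such that $s(f)=s(e_i)$ and $f\ne e_i$ for some $i$. -/

import Mathlib

/-- The Boolean semifield `𝐁 = {0, 1}`, in which `1 + 1 = 1`. -/
def BooleanSemifield : Type := Bool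

namespace BooleanSemifield

instance : DecidableEq BooleanSemifield := inferInstanceAs (DecidableEq Bool)

instance : Fintype BooleanSemifield := inferInstanceAs (Fintype Bool)

instance : Zero BooleanSemifield := ⟨false⟩

instance : One BooleanSemifield := ⟨true⟩

instance : Add BooleanSemifield := ⟨or⟩

instance : Mul BooleanSemifield := ⟨and⟩

/-- Addition is `or`, multiplication is `and`, `0 = false`, `1 = true`. -/
instance : CommSemiring BooleanSemifield where
  add_assoc := Bool.or_assoc
  zero_add := Bool.false_or
  add_zero := Bool.or_false
  add_comm := Bool.or_comm
  mul_assoc := Bool.and_assoc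
  one_mul := Bool.true_and
  mul_one := Bool.and_true
  mul_comm := Bool.and_comm
  zero_mul := Bool.false_and
  mul_zero := Bool.and_false
  left_distrib := Bool.and_or_distrib_left
  right_distrib := Bool.and_or_distrib_right
  nsmul := nsmulRec

end BooleanSemifield

/-- A hemiring is congruence-simple if the diagonal congruence `⊥` and the universal congruence
`⊤` are its only congruences. Hemirings are Mathlib's `NonUnitalSemiring`s. -/
def IsCongruenceSimple (R : Type*) [NonUnitalSemiring R] : Prop :=
  ∀ ρ : RingCon R, ρ = ⊥ ∨ ρ = ⊤

/-- A directed graph with vertex set `V` and edge set `E`, given by its source map `s` and its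
range map `r`. Loops, multiple edges and infinite sets `V`, `E` are allowed. -/
structure DirectedGraph (V E : Type*) where
  /-- the source of an edge -/
  s : E → V
  /-- the range of an edge -/
  r : E → V

namespace DirectedGraph

variable {V E : Type*} (Γ : DirectedGraph V E)

/-- Every vertex emits only finitely many edges. -/
def RowFinite : Prop := ∀ v : V, {e : E | Γ.s e = v}.Finite

/-- A vertex is regular if it emits at least one and only finitely many edges. -/
def IsRegular (v : V) : Prop := {e : E | Γ.s e = v}.Nonempty ∧ {e : E | Γ.s e = v}.Finite

/-- A set of vertices is hereditary if it contains the range of each edge whose source it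
contains. -/
def IsHereditary (H : Set V) : Prop := ∀ e : E, Γ.s e ∈ H → Γ.r e ∈ H

/-- A set of vertices is saturated if it contains each regular vertex all of whose emitted edges
have their ranges in the set. -/
def IsSaturated (H : Set V) : Prop :=
  ∀ v : V, Γ.IsRegular v → (∀ e : E, Γ.s e = v → Γ.r e ∈ H) → v ∈ H

/-- `p = [e₁, …, eₙ]` is a cycle: `n ≥ 1`, `r(eᵢ) = s(eᵢ₊₁)` for `1 ≤ i < n`,
`r(eₙ) = s(e₁)`, and the vertices `s(e₁), …, s(eₙ)` are distinct. -/
structure IsCycle (p : List E) : Prop where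
  ne_nil : p ≠ []
  isPath : p.IsChain (fun e f => Γ.r e = Γ.s f)
  closed : Γ.r (p.getLast ne_nil) = Γ.s (p.head ne_nil)
  sources_distinct : (p.map Γ.s).Nodup

/-- The edge `f` is an exit for the path `p`: it has the same source as some edge `e` of `p`, but
is different from `e`. -/
def IsExit (f : E) (p : List E) : Prop := ∃ e ∈ p, Γ.s f = Γ.s e ∧ f ≠ e

end DirectedGraph

namespace LeavittPath

/-- The generators `V ∪ E ∪ E*` (a disjoint union). -/
inductive Generator (V E : Type*) where
  | vertex (v : V) : Generator V E
  | edge (e : E) : Generator V E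
  | ghost (e : E) : Generator V E

/-- The free (not necessarily unital) associative `S`-algebra on `V ∪ E ∪ E*`: the free
`S`-semimodule on the nonempty words in the generators, multiplied by concatenation. -/
abbrev FreeAlg (S V E : Type*) [CommSemiring S] : Type _ :=
  MonoidAlgebra S (FreeSemigroup (Generator V E))

section

variable (S : Type*) [CommSemiring S] {V E : Type*}

/-- A generator as an element of the free algebra. -/
noncomputable def gen (x : Generator V E) : FreeAlg S V E :=
  MonoidAlgebra.single (FreeSemigroup.of x) 1

/-- The vertex `v` in the free algebra. -/
noncomputable abbrev vtx (v : V) : FreeAlg S V E := gen S (.vertex v)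

/-- The edge `e` in the free algebra. -/
noncomputable abbrev edg (e : E) : FreeAlg S V E := gen S (.edge e)

/-- The ghost edge `e*` in the free algebra. -/
noncomputable abbrev gho (e : E) : FreeAlg S V E := gen S (.ghost e)

/-- The defining relations of the Leavitt path algebra. -/
inductive Rel (Γ : DirectedGraph V E) : FreeAlg S V E → FreeAlg S V E → Prop
  | vertex_idem (v : V) : Rel Γ (vtx S v * vtx S v) (vtx S v)
  | vertex_orth (v w : V) (h : v ≠ w) : Rel Γ (vtx S v * vtx S w) 0
  | source_edge (e : E) : Rel Γ (vtx S (Γ.s e) * edg S e) (edg S e)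
  | edge_range (e : E) : Rel Γ (edg S e * vtx S (Γ.r e)) (edg S e)
  | range_ghost (e : E) : Rel Γ (vtx S (Γ.r e) * gho S e) (gho S e)
  | ghost_source (e : E) : Rel Γ (gho S e * vtx S (Γ.s e)) (gho S e)
  | ghost_edge_self (e : E) : Rel Γ (gho S e * edg S e) (vtx S (Γ.r e))
  | ghost_edge_ne (e f : E) (h : e ≠ f) : Rel Γ (gho S e * edg S f) 0
  | regular (v : V) (hv : Γ.IsRegular v) :
      Rel Γ (vtx S v) (∑ e ∈ hv.2.toFinset, edg S e * gho S e)

/-- The `S`-algebra congruence generated by the defining relations. (The hemiring congruence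
generated by all scalar multiples of the relations is compatible with scalars; the scalars have to
be put in because the free algebra need not contain them.) -/
noncomputable def con (Γ : DirectedGraph V E) : RingCon (FreeAlg S V E) :=
  ringConGen fun x y => ∃ (c : S) (a b : FreeAlg S V E), Rel S Γ a b ∧ x = c • a ∧ y = c • b

theorem con_smul (Γ : DirectedGraph V E) (c : S) {x y : FreeAlg S V E} (h : con S Γ x y) :
    con S Γ (c • x) (c • y) := by
  change RingConGen.Rel _ x y at h
  induction h with
  | of x y h =>
    obtain ⟨d, a, b, hab, rfl, rfl⟩ := h
    exact RingConGen.Rel.of _ _ ⟨c * d, a, b, hab, smul_smul _ _ _, smul_smul _ _ _⟩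
  | refl x => exact (con S Γ).refl _
  | symm _ ih => exact (con S Γ).symm ih
  | trans _ _ ih₁ ih₂ => exact (con S Γ).trans ih₁ ih₂
  | add _ _ ih₁ ih₂ => rw [smul_add, smul_add]; exact (con S Γ).add ih₁ ih₂
  | mul _ h ih₁ _ =>
    rw [← smul_mul_assoc, ← smul_mul_assoc]; exact (con S Γ).mul ih₁ h

end

end LeavittPath

/-- The Leavitt path algebra `L_S(Γ)` of the graph `Γ` with coefficients in the commutative
semiring `S`. -/
def LeavittPathAlgebra (S : Type*) [CommSemiring S] {V E : Type*} (Γ : DirectedGraph V E) :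
    Type _ :=
  (LeavittPath.con S Γ).Quotient

namespace LeavittPathAlgebra

variable (S : Type*) [CommSemiring S] {V E : Type*} (Γ : DirectedGraph V E)

noncomputable instance : NonUnitalSemiring (LeavittPathAlgebra S Γ) :=
  inferInstanceAs (NonUnitalSemiring (LeavittPath.con S Γ).Quotient)

/-- The `S`-semimodule structure, induced from the free algebra. -/
noncomputable instance : Module S (LeavittPathAlgebra S Γ) where
  smul c := Quotient.map (c • ·) fun _ _ h => LeavittPath.con_smul S Γ c h
  one_smul := by rintro ⟨x⟩; exact congrArg (Quotient.mk _) (one_smul S x)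
  mul_smul := by rintro c d ⟨x⟩; exact congrArg (Quotient.mk _) (mul_smul c d x)
  smul_zero c := congrArg (Quotient.mk _) (smul_zero c)
  smul_add := by rintro c ⟨x⟩ ⟨y⟩; exact congrArg (Quotient.mk _) (smul_add c x y)
  add_smul := by rintro c d ⟨x⟩; exact congrArg (Quotient.mk _) (add_smul c d x)
  zero_smul := by rintro ⟨x⟩; exact congrArg (Quotient.mk _) (zero_smul S x)

instance : IsScalarTower S (LeavittPathAlgebra S Γ) (LeavittPathAlgebra S Γ) where
  smul_assoc := by
    rintro c ⟨x⟩ ⟨y⟩; exact congrArg (Quotient.mk _) (smul_mul_assoc c x y)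

instance : SMulCommClass S (LeavittPathAlgebra S Γ) (LeavittPathAlgebra S Γ) where
  smul_comm := by
    rintro c ⟨x⟩ ⟨y⟩; exact congrArg (Quotient.mk _) (mul_smul_comm c x y).symm

end LeavittPathAlgebra

/-! Necessity rests on representations by relations on `V × ℤ`. Edges act through a branching system
outside a hereditary saturated set `H`, so exactly the vertices in `H` act as zero. Over a
congruence-simple algebra a representation in which some vertex acts nontrivially is faithful
(`IsCongruenceSimple.injective_of_ne_zero`). For proper nonempty `H` this forces a vertex of `H` to
vanish, although it survives in the representation for `∅`. On a cycle without exit every edge may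
act as a shift by any prescribed `k` (`relFamily_real`): `k = 0` forces the cycle to equal its base
vertex, and `k = 1` refutes this.

For sufficiency, addition is idempotent, so `a + b = a` reads `b ≤ a`. Monomials `p q*` span
additively (`closure_monomials`). A congruence other than the diagonal makes some `a` absorb a
monomial that is not below it in the algebra. Compression between `p*` and `q` replaces the monomial
by a vertex (`add_real_mul_ghost`). Compression by a long path, or one ending in a sink, then turns
`a` into a sum of closed paths and closed ghost paths (`exists_walk`, `exists_compression_mem`); the
vertex itself is no summand, because it is not absorbed. Exits provide a further path whose
compression kills this sum (`exists_compression_eq_zero`), leaving a vertex congruent to zero. The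
vertices congruent to zero form a hereditary saturated set, hence all of `V`, and the congruence is
universal. -/

namespace DirectedGraph

/-! ### Walks, closed walks and exits -/

variable {V E : Type*} {Γ : DirectedGraph V E}

variable (Γ) in
/-- `Γ.IsWalk v p w`: the list of edges `p` is a path from `v` to `w`. -/
def IsWalk : V → List E → V → Prop
  | v, [], w => v = w
  | v, e :: p, w => Γ.s e = v ∧ IsWalk (Γ.r e) p w

@[simp]
theorem isWalk_nil {v w : V} : Γ.IsWalk v [] w ↔ v = w := Iff.rfl

@[simp]
theorem isWalk_cons {v w : V} {e : E} {p : List E} :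
    Γ.IsWalk v (e :: p) w ↔ Γ.s e = v ∧ Γ.IsWalk (Γ.r e) p w := Iff.rfl

theorem isWalk_append {v w : V} {p q : List E} :
    Γ.IsWalk v (p ++ q) w ↔ ∃ u, Γ.IsWalk v p u ∧ Γ.IsWalk u q w := by
  induction p generalizing v with
  | nil => simp
  | cons e p ih => simp [ih, and_assoc]

theorem IsWalk.append {u v w : V} {p q : List E} (hp : Γ.IsWalk u p v) (hq : Γ.IsWalk v q w) :
    Γ.IsWalk u (p ++ q) w := isWalk_append.2 ⟨v, hp, hq⟩

theorem IsWalk.target_unique {v w w' : V} {p : List E} (h : Γ.IsWalk v p w)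
    (h' : Γ.IsWalk v p w') : w = w' := by
  induction p generalizing v with
  | nil => exact h.symm.trans h'
  | cons e p ih => exact ih h.2 h'.2

theorem isWalk_iff_isChain {v w : V} {p : List E} (hp : p ≠ []) :
    Γ.IsWalk v p w ↔ Γ.s (p.head hp) = v ∧ p.IsChain (fun e f => Γ.r e = Γ.s f) ∧
      Γ.r (p.getLast hp) = w := by
  induction p generalizing v with
  | nil => exact absurd rfl hp
  | cons e p ih =>
    cases p with
    | nil => simp
    | cons f p =>
      rw [isWalk_cons, ih (by simp)]
      simp [eq_comm, and_assoc]

theorem IsWalk.flatten_replicate {v : V} {c : List E} (hc : Γ.IsWalk v c v) (k : ℕ) :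
    Γ.IsWalk v (List.replicate k c).flatten v := by
  induction k with
  | zero => simp
  | succ k ih => simpa [List.replicate_succ] using hc.append ih

theorem IsWalk.isCycle {v : V} {c : List E} (hc : Γ.IsWalk v c v) (hne : c ≠ [])
    (hd : (c.map Γ.s).Nodup) : Γ.IsCycle c := by
  obtain ⟨h1, h2, h3⟩ := (isWalk_iff_isChain hne).1 hc
  exact ⟨hne, h2, h3.trans h1.symm, hd⟩

theorem IsCycle.isWalk {c : List E} (hc : Γ.IsCycle c) :
    Γ.IsWalk (Γ.s (c.head hc.ne_nil)) c (Γ.s (c.head hc.ne_nil)) :=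
  (isWalk_iff_isChain hc.ne_nil).2 ⟨rfl, hc.isPath, hc.closed⟩

theorem _root_.List.exists_eq_append_of_not_nodup_map {α β : Type*} (f : α → β) {l : List α}
    (h : ¬ (l.map f).Nodup) :
    ∃ (a : List α) (x : α) (b : List α) (y : α) (c : List α),
      l = a ++ x :: b ++ y :: c ∧ f x = f y := by
  induction l with
  | nil => simp at h
  | cons z l ih =>
    by_cases hl : (l.map f).Nodup
    · have hz : f z ∈ l.map f := by simpa [hl] using h
      obtain ⟨y, hy, hyz⟩ := List.mem_map.1 hz
      obtain ⟨b, c, rfl⟩ := List.append_of_mem hy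
      exact ⟨[], z, b, y, c, rfl, hyz.symm⟩
    · obtain ⟨a, x, b, y, c, rfl, hxy⟩ := ih hl
      exact ⟨z :: a, x, b, y, c, rfl, hxy⟩

/-- If each cycle has an exit, then so does each closed walk of positive length. -/
theorem IsWalk.exists_isExit (hΓ : ∀ p : List E, Γ.IsCycle p → ∃ f : E, Γ.IsExit f p) {v : V}
    {c : List E} (hc : Γ.IsWalk v c v) (hne : c ≠ []) : ∃ f : E, Γ.IsExit f c := by
  induction hn : c.length using Nat.strong_induction_on generalizing v c with
  | _ n ih =>
    by_cases hd : (c.map Γ.s).Nodup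
    · exact hΓ c (hc.isCycle hne hd)
    -- A repeated source cuts out the shorter closed walk `x :: b`; its edges belong to `c`, so its
    -- exit serves for `c`.
    · obtain ⟨a, x, b, y, d, rfl, hxy⟩ := List.exists_eq_append_of_not_nodup_map Γ.s hd
      obtain ⟨u, hu, hyd⟩ := isWalk_append.1 hc
      obtain ⟨u', -, hx⟩ := isWalk_append.1 hu
      have hu' : u = u' := by rw [← hyd.1, ← hx.1, hxy]
      subst hu'
      obtain ⟨f, e, he, hf⟩ := ih (x :: b).length (by simp at hn ⊢; omega) hx (by simp) rfl
      exact ⟨f, e, by simp at he ⊢; tauto, hf⟩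

/-- Iterating the hypothesis makes `t` a prefix of `k` copies of `c` followed by `t`; since `c` is
nonempty, the copies alone are long enough once `k` reaches the length of `t`. -/
theorem _root_.List.prefix_flatten_replicate {α : Type*} {c t : List α} (hne : c ≠ []) (h : t <+: c ++ t)
    {k : ℕ} (hk : t.length ≤ k) : t <+: (List.replicate k c).flatten := by
  have key : ∀ k : ℕ, t <+: (List.replicate k c).flatten ++ t := by
    intro k
    induction k with
    | zero => simp
    | succ k ih =>
      rw [List.replicate_succ, List.flatten_cons, List.append_assoc]
      exact h.trans ((List.prefix_append_right_inj c).2 ih)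
  refine List.prefix_of_prefix_length_le (key k) (List.prefix_append _ _) (hk.trans ?_)
  have : 0 < c.length := List.length_pos_iff.2 hne
  simp only [List.length_flatten, List.map_replicate, List.sum_replicate, smul_eq_mul]
  exact Nat.le_mul_of_pos_right k this

/-- Any walk from the base of a closed walk `c` with an exit extends to a walk `t` that is not a
prefix of `c ++ t`. -/
theorem IsWalk.exists_extension {w u : V} {c t : List E} (hc : Γ.IsWalk w c w)
    (hex : ∃ f : E, Γ.IsExit f c) (ht : Γ.IsWalk w t u) :
    ∃ (q : List E) (u' : V), Γ.IsWalk u q u' ∧ ¬ (t ++ q) <+: c ++ (t ++ q) := by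
  obtain ⟨f, e, he, hs, hfe⟩ := hex
  have hne : c ≠ [] := List.ne_nil_of_mem he
  -- Otherwise every walk that extends `t` follows powers of `c`. Extend `t` back to `w`, then along
  -- `c` up to `e`, and leave through `f`: comparison with the power of `c` gives `f = e`.
  by_contra! hcon
  have ht0 : t <+: (List.replicate t.length c).flatten := by
    have := hcon [] u rfl
    rw [List.append_nil] at this
    exact List.prefix_flatten_replicate hne this le_rfl
  obtain ⟨q, hq⟩ := ht0
  have hqw : Γ.IsWalk u q w := by
    have := hc.flatten_replicate t.length
    rw [← hq] at this
    obtain ⟨u', hu', h⟩ := isWalk_append.1 this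
    rwa [ht.target_unique hu']
  obtain ⟨c₁, c₂, rfl⟩ := List.append_of_mem he
  obtain ⟨x, hc₁, hx⟩ := isWalk_append.1 hc
  have hwalk : Γ.IsWalk u (q ++ (c₁ ++ [f])) (Γ.r f) :=
    hqw.append (hc₁.append (by simpa using hs.trans hx.1))
  have h1 := List.prefix_flatten_replicate hne (hcon _ _ hwalk)
    -- The first `t.length` copies spell `t ++ q`, the next one contains `c₁ ++ [e]`, and the rest
    -- meet the length bound.
    (k := t.length + 1 + (t ++ (q ++ (c₁ ++ [f]))).length) (by omega)
  have h2 : t ++ (q ++ (c₁ ++ [e])) <+: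
      (List.replicate (t.length + 1 + (t ++ (q ++ (c₁ ++ [f]))).length)
        (c₁ ++ e :: c₂)).flatten := by
    rw [List.replicate_add, List.flatten_append, List.replicate_succ', List.flatten_append, ← hq]
    refine ⟨c₂ ++ (List.replicate (t ++ (q ++ (c₁ ++ [f]))).length (c₁ ++ e :: c₂)).flatten, ?_⟩
    simp
  have h3 := (List.prefix_of_prefix_length_le h1 h2 (by simp)).eq_of_length (by simp)
  simp at h3
  exact hfe h3

end DirectedGraph

/-! ### Families satisfying the relations, and their monomials `p q*` -/

namespace LeavittPath

open DirectedGraph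

/-- A family of elements of a hemiring that satisfies the defining relations of the Leavitt path
algebra of `Γ`. -/
structure Family {V E : Type*} (Γ : DirectedGraph V E) (A : Type*) [NonUnitalSemiring A] where
  /-- the vertices -/
  vtx : V → A
  /-- the edges -/
  edg : E → A
  /-- the ghost edges -/
  gho : E → A
  vertex_idem (v : V) : vtx v * vtx v = vtx v
  vertex_orth (v w : V) (h : v ≠ w) : vtx v * vtx w = 0
  source_edge (e : E) : vtx (Γ.s e) * edg e = edg e
  edge_range (e : E) : edg e * vtx (Γ.r e) = edg e
  range_ghost (e : E) : vtx (Γ.r e) * gho e = gho e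
  ghost_source (e : E) : gho e * vtx (Γ.s e) = gho e
  ghost_edge_self (e : E) : gho e * edg e = vtx (Γ.r e)
  ghost_edge_ne (e f : E) (h : e ≠ f) : gho e * edg f = 0
  regular (v : V) (hv : Γ.IsRegular v) : vtx v = ∑ e ∈ hv.2.toFinset, edg e * gho e

namespace Family

variable {V E : Type*} {Γ : DirectedGraph V E} {A : Type*} [NonUnitalSemiring A]
  (F : Family Γ A)

/-- The product of the edges of a path that starts in `v`. -/
def real : V → List E → A
  | v, [] => F.vtx v
  | _, e :: p => F.edg e * real (Γ.r e) p

/-- The product, in reverse order, of the ghost edges of a path that starts in `v`. -/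
def ghost : V → List E → A
  | v, [] => F.vtx v
  | _, e :: p => ghost (Γ.r e) p * F.gho e

@[simp] theorem real_nil (v : V) : F.real v [] = F.vtx v := rfl

@[simp] theorem real_cons (v : V) (e : E) (p : List E) :
    F.real v (e :: p) = F.edg e * F.real (Γ.r e) p := rfl

@[simp] theorem ghost_nil (v : V) : F.ghost v [] = F.vtx v := rfl

@[simp] theorem ghost_cons (v : V) (e : E) (p : List E) :
    F.ghost v (e :: p) = F.ghost (Γ.r e) p * F.gho e := rfl

variable {F} {u v w z : V} {p q : List E}

theorem vtx_mul_real (h : Γ.IsWalk v p w) : F.vtx v * F.real v p = F.real v p := by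
  cases p with
  | nil => exact F.vertex_idem v
  | cons e p => rw [real_cons, ← mul_assoc, ← h.1, F.source_edge]

theorem ghost_mul_vtx (h : Γ.IsWalk v p w) : F.ghost v p * F.vtx v = F.ghost v p := by
  cases p with
  | nil => exact F.vertex_idem v
  | cons e p => rw [ghost_cons, mul_assoc, ← h.1, F.ghost_source]

theorem real_mul_vtx (h : Γ.IsWalk v p w) : F.real v p * F.vtx w = F.real v p := by
  induction p generalizing v with
  | nil => rw [isWalk_nil.1 h]; exact F.vertex_idem w
  | cons e p ih => rw [real_cons, mul_assoc, ih h.2]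

theorem vtx_mul_ghost (h : Γ.IsWalk v p w) : F.vtx w * F.ghost v p = F.ghost v p := by
  induction p generalizing v with
  | nil => rw [isWalk_nil.1 h]; exact F.vertex_idem w
  | cons e p ih => rw [ghost_cons, ← mul_assoc, ih h.2]

theorem vtx_mul_real_of_ne (h : Γ.IsWalk v p w) (hu : u ≠ v) : F.vtx u * F.real v p = 0 := by
  rw [← vtx_mul_real h, ← mul_assoc, F.vertex_orth u v hu, zero_mul]

theorem ghost_mul_vtx_of_ne (h : Γ.IsWalk v p w) (hu : v ≠ u) : F.ghost v p * F.vtx u = 0 := by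
  rw [← ghost_mul_vtx h, mul_assoc, F.vertex_orth v u hu, mul_zero]

theorem real_append (hp : Γ.IsWalk u p v) (hq : Γ.IsWalk v q w) :
    F.real u (p ++ q) = F.real u p * F.real v q := by
  induction p generalizing u with
  | nil => rw [isWalk_nil.1 hp, real_nil, vtx_mul_real hq]; rfl
  | cons e p ih => rw [List.cons_append, real_cons, ih hp.2, real_cons, mul_assoc]

theorem ghost_append (hp : Γ.IsWalk u p v) (hq : Γ.IsWalk v q w) :
    F.ghost u (p ++ q) = F.ghost v q * F.ghost u p := by
  induction p generalizing u with
  | nil => rw [isWalk_nil.1 hp, ghost_nil, ghost_mul_vtx hq]; rfl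
  | cons e p ih => rw [List.cons_append, ghost_cons, ih hp.2, ghost_cons, mul_assoc]

/-- The product of a ghost path and a path vanishes, or one of the two cancels. -/
theorem ghost_mul_real_cases (hp : Γ.IsWalk u p v) (hq : Γ.IsWalk w q z) :
    F.ghost u p * F.real w q = 0 ∨
      (∃ p', p = q ++ p' ∧ Γ.IsWalk z p' v ∧ F.ghost u p * F.real w q = F.ghost z p') ∨
      (∃ q', q = p ++ q' ∧ Γ.IsWalk v q' z ∧ F.ghost u p * F.real w q = F.real v q') := by
  by_cases huw : u = w
  · subst huw
    induction p generalizing u q with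
    | nil =>
      obtain rfl := isWalk_nil.1 hp
      exact .inr (.inr ⟨q, rfl, hq, vtx_mul_real hq⟩)
    | cons e p ih =>
      cases q with
      | nil =>
        obtain rfl := isWalk_nil.1 hq
        exact .inr (.inl ⟨e :: p, rfl, hp, ghost_mul_vtx hp⟩)
      | cons f q =>
        have hassoc : F.ghost u (e :: p) * F.real u (f :: q) =
            F.ghost (Γ.r e) p * (F.gho e * F.edg f) * F.real (Γ.r f) q := by
          simp only [ghost_cons, real_cons, mul_assoc]
        by_cases hef : e = f
        · subst hef
          rw [hassoc, F.ghost_edge_self, ghost_mul_vtx hp.2]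
          simpa using ih hp.2 hq.2
        · exact .inl (by rw [hassoc, F.ghost_edge_ne e f hef, mul_zero, zero_mul])
  · exact .inl (by rw [← ghost_mul_vtx hp, mul_assoc, vtx_mul_real_of_ne hq huw, mul_zero])

theorem ghost_mul_real_self (hp : Γ.IsWalk v p w) : F.ghost v p * F.real v p = F.vtx w := by
  induction p generalizing v with
  | nil => rw [isWalk_nil.1 hp]; exact F.vertex_idem w
  | cons e p ih =>
    rw [ghost_cons, real_cons, mul_assoc, ← mul_assoc (F.gho e), F.ghost_edge_self,
      vtx_mul_real hp.2, ih hp.2]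

variable (F) in
/-- The products `p q*` of a path and a ghost path. -/
def monomials : Set A :=
  {m | ∃ (u v w : V) (p q : List E), Γ.IsWalk u p w ∧ Γ.IsWalk v q w ∧
    m = F.real u p * F.ghost v q}

variable (F) in
theorem vtx_mem_monomials (v : V) : F.vtx v ∈ F.monomials :=
  ⟨v, v, v, [], [], rfl, rfl, (F.vertex_idem v).symm⟩

variable (F) in
theorem edg_mem_monomials (e : E) : F.edg e ∈ F.monomials :=
  ⟨Γ.s e, Γ.r e, Γ.r e, [e], [], ⟨rfl, rfl⟩, rfl, by simp [F.edge_range]⟩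

variable (F) in
theorem gho_mem_monomials (e : E) : F.gho e ∈ F.monomials :=
  ⟨Γ.r e, Γ.s e, Γ.r e, [], [e], rfl, ⟨rfl, rfl⟩, by simp [F.range_ghost]⟩

theorem vtx_mul_monomial {m : A} (hm : m ∈ F.monomials) (x : V) :
    F.vtx x * m = 0 ∨ F.vtx x * m = m := by
  obtain ⟨u, v, w, p, q, hp, hq, rfl⟩ := hm
  rw [← mul_assoc]
  by_cases hx : x = u
  · subst hx; exact .inr (by rw [vtx_mul_real hp])
  · exact .inl (by rw [vtx_mul_real_of_ne hp hx, zero_mul])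

theorem monomial_mul_vtx {m : A} (hm : m ∈ F.monomials) (x : V) :
    m * F.vtx x = 0 ∨ m * F.vtx x = m := by
  obtain ⟨u, v, w, p, q, hp, hq, rfl⟩ := hm
  rw [mul_assoc]
  by_cases hx : v = x
  · subst hx; exact .inr (by rw [ghost_mul_vtx hq])
  · exact .inl (by rw [ghost_mul_vtx_of_ne hq hx, mul_zero])

theorem edg_mul_monomial {m : A} (hm : m ∈ F.monomials) (e : E) :
    F.edg e * m = 0 ∨ F.edg e * m ∈ F.monomials := by
  obtain ⟨u, v, w, p, q, hp, hq, rfl⟩ := hm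
  by_cases hx : Γ.r e = u
  · subst hx
    exact .inr ⟨Γ.s e, v, w, e :: p, q, ⟨rfl, hp⟩, hq, by rw [real_cons, mul_assoc]⟩
  · left
    rw [← F.edge_range, mul_assoc, ← mul_assoc (F.vtx _), vtx_mul_real_of_ne hp hx, zero_mul,
      mul_zero]

theorem gho_mul_monomial {m : A} (hm : m ∈ F.monomials) (e : E) :
    F.gho e * m = 0 ∨ F.gho e * m ∈ F.monomials := by
  obtain ⟨u, v, w, p, q, hp, hq, rfl⟩ := hm
  have he : Γ.IsWalk (Γ.s e) [e] (Γ.r e) := ⟨rfl, rfl⟩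
  have hge : F.gho e = F.ghost (Γ.s e) [e] := by simp [F.range_ghost]
  rw [hge, ← mul_assoc]
  rcases ghost_mul_real_cases (F := F) he hp with h | ⟨p', h1, h2, h3⟩ | ⟨q', h1, h2, h3⟩
  · exact .inl (by rw [h, zero_mul])
  · rw [h3, ← ghost_append hq h2]
    exact .inr ⟨Γ.r e, v, Γ.r e, [], q ++ p', rfl, hq.append h2,
      (vtx_mul_ghost (hq.append h2)).symm⟩
  · rw [h3]
    exact .inr ⟨Γ.r e, v, w, q', q, h2, hq, rfl⟩

variable {B : Type*} [NonUnitalSemiring B]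

theorem map_real (φ : A →ₙ+* B) {F : Family Γ A} {G : Family Γ B}
    (hv : ∀ v, φ (F.vtx v) = G.vtx v) (he : ∀ e, φ (F.edg e) = G.edg e) (v : V) (p : List E) :
    φ (F.real v p) = G.real v p := by
  induction p generalizing v with
  | nil => exact hv v
  | cons e p ih => rw [real_cons, map_mul, he, ih, real_cons]

end Family

end LeavittPath

/-! ### Universal property and additive spanning by monomials -/

namespace LeavittPathAlgebra

open LeavittPath

variable (S : Type*) [CommSemiring S] {V E : Type*} (Γ : DirectedGraph V E)

/-- The quotient map from the free algebra. -/
noncomputable def mk : FreeAlg S V E →ₙ+* LeavittPathAlgebra S Γ where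
  toFun x := (x : (con S Γ).Quotient)
  map_zero' := rfl
  map_add' _ _ := rfl
  map_mul' _ _ := rfl

theorem mk_surjective : Function.Surjective (mk S Γ) := Quotient.mk_surjective

variable {S Γ} in
theorem mk_eq_of_rel {a b : FreeAlg S V E} (h : Rel S Γ a b) : mk S Γ a = mk S Γ b :=
  (RingCon.eq _).2 (RingConGen.Rel.of _ _ ⟨1, a, b, h, (one_smul _ _).symm, (one_smul _ _).symm⟩)

/-- The generators of the Leavitt path algebra. -/
noncomputable def family : Family Γ (LeavittPathAlgebra S Γ) where
  vtx v := mk S Γ (vtx S v)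
  edg e := mk S Γ (edg S e)
  gho e := mk S Γ (gho S e)
  vertex_idem v := by rw [← map_mul]; exact mk_eq_of_rel (.vertex_idem v)
  vertex_orth v w h := by rw [← map_mul, mk_eq_of_rel (.vertex_orth v w h), map_zero]
  source_edge e := by rw [← map_mul]; exact mk_eq_of_rel (.source_edge e)
  edge_range e := by rw [← map_mul]; exact mk_eq_of_rel (.edge_range e)
  range_ghost e := by rw [← map_mul]; exact mk_eq_of_rel (.range_ghost e)
  ghost_source e := by rw [← map_mul]; exact mk_eq_of_rel (.ghost_source e)
  ghost_edge_self e := by rw [← map_mul]; exact mk_eq_of_rel (.ghost_edge_self e)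
  ghost_edge_ne e f h := by rw [← map_mul, mk_eq_of_rel (.ghost_edge_ne e f h), map_zero]
  regular v hv := by
    rw [mk_eq_of_rel (.regular v hv), map_sum]
    simp_rw [map_mul]

variable {S Γ} in
/-- A family of elements of an algebra that satisfies the defining relations is the image of the
generators under a homomorphism. -/
theorem exists_hom {A : Type*} [NonUnitalSemiring A] [Module S A] [IsScalarTower S A A]
    [SMulCommClass S A A] (G : Family Γ A) :
    ∃ φ : LeavittPathAlgebra S Γ →ₙ+* A, (∀ v, φ ((family S Γ).vtx v) = G.vtx v) ∧
      ∀ e, φ ((family S Γ).edg e) = G.edg e := by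
  let g : Generator V E → A := fun x => match x with
    | .vertex v => G.vtx v
    | .edge e => G.edg e
    | .ghost e => G.gho e
  let ψ : FreeAlg S V E →ₙₐ[S] A := MonoidAlgebra.liftMagma S (FreeSemigroup.lift g)
  have hψ (x : Generator V E) : ψ (gen S x) = g x := by
    simp [ψ, gen]
  have hrel {a b : FreeAlg S V E} (h : Rel S Γ a b) : ψ a = ψ b := by
    cases h with
    | regular v hv => simpa [hψ, g, map_sum] using G.regular v hv
    | _ => simp [g, G.vertex_idem, G.vertex_orth, G.source_edge, G.edge_range, G.range_ghost,
        G.ghost_source, G.ghost_edge_self, G.ghost_edge_ne, *]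
  have hcon {a b : FreeAlg S V E} (h : con S Γ a b) : ψ a = ψ b := by
    -- The kernel congruence of `ψ` contains all scalar multiples of the relations, hence the
    -- congruence they generate.
    have : con S Γ ≤ RingCon.comap ⊥ ψ := by
      refine RingCon.ringConGen_le.2 ?_
      rintro _ _ ⟨c, a, b, hab, rfl, rfl⟩
      change ψ _ = ψ _
      rw [map_smul, map_smul, hrel hab]
    exact this h
  let φ : LeavittPathAlgebra S Γ →ₙ+* A :=
    { toFun := Quotient.lift ψ (fun _ _ => hcon)
      map_zero' := map_zero ψ
      map_mul' := by rintro ⟨x⟩ ⟨y⟩; exact map_mul ψ x y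
      map_add' := by rintro ⟨x⟩ ⟨y⟩; exact map_add ψ x y }
  exact ⟨φ, fun v => hψ (.vertex v), fun e => hψ (.edge e)⟩

end LeavittPathAlgebra

theorem BooleanSemifield.eq_zero_or_one (b : BooleanSemifield) : b = 0 ∨ b = 1 := by
  cases b
  exacts [.inl rfl, .inr rfl]

namespace LeavittPathAlgebra

open LeavittPath

variable {V E : Type*} (Γ : DirectedGraph V E)

theorem add_self (a : LeavittPathAlgebra BooleanSemifield Γ) : a + a = a := by
  have h : (1 + 1 : BooleanSemifield) = 1 := rfl
  rw [← one_smul BooleanSemifield a, ← add_smul, h]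

/-- Left multiplication by a generator sends a monomial to a monomial or to zero, so every word does
reduce to one of these. Boolean coefficients are 0 or 1, so additive closure suffices. -/
theorem closure_monomials :
    AddSubmonoid.closure (family BooleanSemifield Γ).monomials = ⊤ := by
  refine eq_top_iff.2 fun x _ => ?_
  obtain ⟨x, rfl⟩ := mk_surjective _ _ x
  set F := family BooleanSemifield Γ
  have hword (y : FreeSemigroup (Generator V E)) :
      mk BooleanSemifield Γ (MonoidAlgebra.single y 1) ∈ insert 0 F.monomials := by
    induction y using FreeSemigroup.recOnMul with
    | ih1 x =>
      right
      cases x with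
      | vertex v => exact F.vtx_mem_monomials v
      | edge e => exact F.edg_mem_monomials e
      | ghost e => exact F.gho_mem_monomials e
    | ih2 x y _ hy =>
      have : mk BooleanSemifield Γ (MonoidAlgebra.single (FreeSemigroup.of x * y) 1) =
          mk BooleanSemifield Γ (gen _ x) * mk BooleanSemifield Γ (MonoidAlgebra.single y 1) := by
        rw [← map_mul, gen, MonoidAlgebra.single_mul_single, one_mul]
      rw [this]
      rcases hy with hy | hy
      · rw [hy, mul_zero]; exact Set.mem_insert _ _
      · cases x with
        | vertex v =>
          rcases Family.vtx_mul_monomial hy v with h | h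
          · exact .inl h
          · exact .inr (by rw [← h] at hy; exact hy)
        | edge e => exact Family.edg_mul_monomial hy e
        | ghost e => exact Family.gho_mul_monomial hy e
  induction x using MonoidAlgebra.induction_linear with
  | zero => exact zero_mem _
  | add a b ha hb => rw [map_add]; exact add_mem (ha trivial) (hb trivial)
  | single y b =>
    rcases BooleanSemifield.eq_zero_or_one b with rfl | rfl
    · rw [MonoidAlgebra.single_zero, map_zero]; exact zero_mem _
    · rcases hword y with h | h
      · rw [h]; exact zero_mem _
      · exact AddSubmonoid.subset_closure h

end LeavittPathAlgebra

/-! ### The hemiring of binary relations -/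

/-- Binary relations on `X`, as a hemiring under union and composition. -/
structure BoolRel (X : Type*) where
  /-- the underlying relation -/
  rel : X → X → Prop

namespace BoolRel

variable {X : Type*}

instance : CoeFun (BoolRel X) fun _ => X → X → Prop := ⟨rel⟩

@[ext]
theorem ext {R T : BoolRel X} (h : ∀ x y, R x y ↔ T x y) : R = T := by
  cases R
  cases T
  congr
  exact funext fun x => funext fun y => propext (h x y)

instance : Zero (BoolRel X) := ⟨⟨fun _ _ => False⟩⟩

instance : Add (BoolRel X) := ⟨fun R T => ⟨fun x y => R x y ∨ T x y⟩⟩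

instance : Mul (BoolRel X) := ⟨fun R T => ⟨fun x z => ∃ y, R x y ∧ T y z⟩⟩

theorem zero_apply (x y : X) : (0 : BoolRel X) x y ↔ False := Iff.rfl

theorem add_apply (R T : BoolRel X) (x y : X) : (R + T) x y ↔ R x y ∨ T x y := Iff.rfl

theorem mul_apply (R T : BoolRel X) (x z : X) : (R * T) x z ↔ ∃ y, R x y ∧ T y z := Iff.rfl

instance : NonUnitalSemiring (BoolRel X) where
  add_assoc _ _ _ := by ext; simp only [add_apply]; tauto
  zero_add _ := by ext; simp only [add_apply, zero_apply]; tauto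
  add_zero _ := by ext; simp only [add_apply, zero_apply]; tauto
  add_comm _ _ := by ext; simp only [add_apply]; tauto
  nsmul := nsmulRec
  left_distrib _ _ _ := by
    ext; simp only [add_apply, mul_apply, and_or_left, exists_or]
  right_distrib _ _ _ := by
    ext; simp only [add_apply, mul_apply, or_and_right, exists_or]
  zero_mul _ := by ext; simp [mul_apply, zero_apply]
  mul_zero _ := by ext; simp [mul_apply, zero_apply]
  mul_assoc _ _ _ := by
    ext; simp only [mul_apply]; grind

theorem sum_apply {ι : Type*} (s : Finset ι) (R : ι → BoolRel X) (x y : X) :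
    (∑ i ∈ s, R i) x y ↔ ∃ i ∈ s, R i x y := by
  classical
  induction s using Finset.induction_on with
  | empty => simp [zero_apply]
  | insert a s ha ih => rw [Finset.sum_insert ha, add_apply, ih]; simp

instance : SMul BooleanSemifield (BoolRel X) := ⟨fun b R => ⟨fun x y => b = 1 ∧ R x y⟩⟩

theorem smul_apply (b : BooleanSemifield) (R : BoolRel X) (x y : X) :
    (b • R) x y ↔ b = 1 ∧ R x y := Iff.rfl

theorem _root_.BooleanSemifield.mul_eq_one (a b : BooleanSemifield) :
    a * b = 1 ↔ a = 1 ∧ b = 1 := by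
  revert a b; decide

theorem _root_.BooleanSemifield.add_eq_one (a b : BooleanSemifield) :
    a + b = 1 ↔ a = 1 ∨ b = 1 := by
  revert a b; decide

theorem _root_.BooleanSemifield.zero_ne_one : (0 : BooleanSemifield) ≠ 1 := by decide

instance : Module BooleanSemifield (BoolRel X) where
  one_smul _ := by ext; simp [smul_apply]
  mul_smul _ _ _ := by ext; simp [smul_apply, BooleanSemifield.mul_eq_one, and_assoc]
  smul_zero _ := by ext; simp [smul_apply, zero_apply]
  smul_add _ _ _ := by ext; simp [smul_apply, add_apply, and_or_left]
  add_smul _ _ _ := by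
    ext; simp [smul_apply, add_apply, BooleanSemifield.add_eq_one, or_and_right]
  zero_smul _ := by ext; simp [smul_apply, zero_apply, BooleanSemifield.zero_ne_one]

instance : IsScalarTower BooleanSemifield (BoolRel X) (BoolRel X) where
  smul_assoc _ _ _ := by ext; simp [smul_apply, mul_apply, and_assoc]

instance : SMulCommClass BooleanSemifield (BoolRel X) (BoolRel X) where
  smul_comm _ _ _ := by ext; simp only [smul_apply, mul_apply, smul_eq_mul]; grind

end BoolRel

/-! ### Branching systems and their representations -/

namespace DirectedGraph

variable {V E : Type*} {Γ : DirectedGraph V E}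

variable (Γ) in
/-- A branching system on the copies of `ℤ` at the vertices outside `H`: for each regular vertex
`v ∉ H` the images of the maps `f e`, for the edges `e` from `v` to vertices outside `H`, partition
the copy of `ℤ` at `v`. -/
structure IsBranching (H : Set V) (f : E → ℤ → ℤ) : Prop where
  injective (e e' : E) (m m' : ℤ) (he : Γ.r e ∉ H) (he' : Γ.r e' ∉ H) (hs : Γ.s e = Γ.s e')
    (hf : f e m = f e' m') : e = e' ∧ m = m'
  surjective (v : V) (hvH : v ∉ H) (hv : Γ.IsRegular v) (n : ℤ) :
    ∃ e m, Γ.s e = v ∧ Γ.r e ∉ H ∧ f e m = n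

variable (Γ) in
/-- The edge `e` is the only one with its source. -/
def IsSoleEdge (e : E) : Prop := ∀ e' : E, Γ.s e' = Γ.s e → e' = e

/-- Finitely many copies of `ℤ`, at least one, are in bijection with `ℤ`. A sole edge has only one
copy to place, so there the bijection can be replaced by a shift. -/
theorem exists_isBranching (hΓ : Γ.RowFinite) {H : Set V} (hH : Γ.IsSaturated H) (k : ℤ) :
    ∃ f : E → ℤ → ℤ, Γ.IsBranching H f ∧ ∀ e, Γ.IsSoleEdge e → ∀ m, f e m = m + k := by
  classical
  let T (v : V) : Type _ := {e : E // Γ.s e = v ∧ Γ.r e ∉ H}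
  have hT (v : V) (h : Nonempty (T v)) : Nonempty (T v × ℤ ≃ ℤ) := by
    have : Finite (T v) := Set.Finite.subset (hΓ v) fun e he => he.1
    exact nonempty_equiv_of_countable
  let φ (v : V) (h : Nonempty (T v)) : T v × ℤ ≃ ℤ := (hT v h).some
  -- The default 0 is harmless: edges with range in `H` play no role in a branching system.
  let f₀ (e : E) (m : ℤ) : ℤ :=
    if he : Γ.r e ∉ H then φ (Γ.s e) ⟨e, rfl, he⟩ (⟨e, rfl, he⟩, m) else 0
  have hf₀ {e : E} {v : V} (hs : Γ.s e = v) (he : Γ.r e ∉ H) (h : Nonempty (T v)) (m : ℤ) :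
      f₀ e m = φ v h (⟨e, hs, he⟩, m) := by
    subst hs; simp only [f₀, dif_pos he]
  refine ⟨fun e m => if Γ.IsSoleEdge e then m + k else f₀ e m, ⟨?_, ?_⟩,
    fun e he m => if_pos he⟩
  · intro e e' m m' he he' hs hf
    by_cases hu : Γ.IsSoleEdge e
    · obtain rfl := hu e' hs.symm
      simp only [if_pos hu] at hf
      exact ⟨rfl, by omega⟩
    · by_cases hu' : Γ.IsSoleEdge e'
      · obtain rfl := hu' e hs
        exact absurd hu' hu
      · simp only [if_neg hu, if_neg hu'] at hf
        have h : Nonempty (T (Γ.s e')) := ⟨e', rfl, he'⟩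
        rw [hf₀ hs he h, hf₀ rfl he' h] at hf
        have := (φ _ h).injective hf
        exact ⟨congrArg (fun z => z.1.1) this, congrArg Prod.snd this⟩
  · intro v hvH hv n
    -- Saturation: were all ranges in `H`, then `v` would be too.
    have h : Nonempty (T v) := by
      by_contra hne
      exact hvH (hH v hv fun e he => by_contra fun hr => hne ⟨e, he, hr⟩)
    obtain ⟨⟨⟨e, hs, he⟩, m⟩, hn⟩ := (φ v h).surjective n
    by_cases hu : Γ.IsSoleEdge e
    · exact ⟨e, n - k, hs, he, by simp [hu]⟩
    · exact ⟨e, m, hs, he, by simp only [if_neg hu]; rw [hf₀ hs he h, hn]⟩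

end DirectedGraph

namespace LeavittPath

open DirectedGraph

variable {V E : Type*} {Γ : DirectedGraph V E}

/-- The relations on `V × ℤ` given by a branching system. -/
def relFamily {H : Set V} {f : E → ℤ → ℤ} (hH : Γ.IsHereditary H) (hf : Γ.IsBranching H f) :
    Family Γ (BoolRel (V × ℤ)) where
  vtx v := ⟨fun x y => x = y ∧ x.1 = v ∧ v ∉ H⟩
  edg e := ⟨fun x y => Γ.r e ∉ H ∧ x = (Γ.s e, f e y.2) ∧ y.1 = Γ.r e⟩
  gho e := ⟨fun y x => Γ.r e ∉ H ∧ x = (Γ.s e, f e y.2) ∧ y.1 = Γ.r e⟩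
  vertex_idem v := by ext; simp only [BoolRel.mul_apply]; grind
  vertex_orth v w h := by ext; simp only [BoolRel.mul_apply, BoolRel.zero_apply]; grind
  source_edge e := by
    -- By heredity, range outside `H` forces source outside `H`, so the source vertex acts as the
    -- identity where needed.
    have := hH e
    ext; simp only [BoolRel.mul_apply]; grind
  edge_range e := by ext; simp only [BoolRel.mul_apply]; grind
  range_ghost e := by ext; simp only [BoolRel.mul_apply]; grind
  ghost_source e := by
    have := hH e
    ext; simp only [BoolRel.mul_apply]; grind
  ghost_edge_self e := by
    ext x y
    simp only [BoolRel.mul_apply]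
    constructor
    · rintro ⟨z, ⟨h1, h2, h3⟩, -, h5, h6⟩
      refine ⟨Prod.ext (h3.trans h6.symm) (hf.injective e e _ _ h1 h1 rfl ?_).2, h3, h1⟩
      exact congrArg Prod.snd (h2.symm.trans h5)
    · rintro ⟨rfl, h1, h2⟩
      exact ⟨_, ⟨h2, rfl, h1⟩, h2, rfl, h1⟩
  ghost_edge_ne e e' h := by
    ext x y
    simp only [BoolRel.mul_apply, BoolRel.zero_apply, iff_false]
    rintro ⟨z, ⟨h1, h2, h3⟩, h4, h5, h6⟩
    obtain ⟨h7, h8⟩ := Prod.mk.inj (h2.symm.trans h5)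
    exact h (hf.injective e e' _ _ h1 h4 h7 h8).1
  regular v hv := by
    ext x y
    simp only [BoolRel.sum_apply, BoolRel.mul_apply, Set.Finite.mem_toFinset, Set.mem_ofPred_eq]
    constructor
    · rintro ⟨rfl, h1, h2⟩
      obtain ⟨e, m, h3, h4, h5⟩ := hf.surjective v h2 hv x.2
      have hx : x = (Γ.s e, f e m) := Prod.ext (h1.trans h3.symm) h5.symm
      exact ⟨e, h3, (Γ.r e, m), ⟨h4, hx, rfl⟩, h4, hx, rfl⟩
    · rintro ⟨e, rfl, z, ⟨h1, h2, h3⟩, -, h5, -⟩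
      exact ⟨h2.trans h5.symm, by rw [h2], fun h => h1 (hH e h)⟩

theorem relFamily_vtx_ne_zero {H : Set V} {f : E → ℤ → ℤ} (hH : Γ.IsHereditary H)
    (hf : Γ.IsBranching H f) {v : V} (hv : v ∉ H) : (relFamily hH hf).vtx v ≠ 0 := by
  intro h
  have h' : (relFamily hH hf).vtx v (v, 0) (v, 0) := ⟨rfl, rfl, hv⟩
  rw [h] at h'
  exact h'

theorem relFamily_vtx_eq_zero {H : Set V} {f : E → ℤ → ℤ} (hH : Γ.IsHereditary H)
    (hf : Γ.IsBranching H f) {v : V} (hv : v ∈ H) : (relFamily hH hf).vtx v = 0 := by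
  ext x y
  exact iff_of_false (fun h => h.2.2 hv) id

/-- A path of sole edges acts by a shift. -/
theorem relFamily_real {f : E → ℤ → ℤ} (h0 : Γ.IsHereditary ∅) (hf : Γ.IsBranching ∅ f) {k : ℤ}
    (hk : ∀ e, Γ.IsSoleEdge e → ∀ m, f e m = m + k) {v w : V} {p : List E}
    (hp : Γ.IsWalk v p w) (hs : ∀ e ∈ p, Γ.IsSoleEdge e) (x y : V × ℤ) :
    (relFamily h0 hf).real v p x y ↔ x.1 = v ∧ y.1 = w ∧ x.2 = y.2 + k * p.length := by
  induction p generalizing v x with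
  | nil =>
    obtain rfl := isWalk_nil.1 hp
    change (x = y ∧ x.1 = v ∧ v ∉ (∅ : Set V)) ↔ _
    simp only [Prod.ext_iff]
    simp
    grind
  | cons e p ih =>
    obtain ⟨rfl, hp⟩ := hp
    rw [Family.real_cons, BoolRel.mul_apply]
    have he := hk e (hs e (by simp))
    have ih := ih hp (fun e he => hs e (by simp [he]))
    constructor
    · rintro ⟨z, ⟨-, h2, h3⟩, h⟩
      obtain ⟨-, h4, h5⟩ := (ih z).1 h
      refine ⟨by rw [h2], h4, ?_⟩
      rw [h2, he, h5]
      push_cast [List.length_cons]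
      ring
    · rintro ⟨h1, h2, h3⟩
      refine ⟨(Γ.r e, y.2 + k * p.length), ⟨by simp, Prod.ext h1 ?_, rfl⟩, (ih _).2 ⟨rfl, h2, rfl⟩⟩
      rw [he, h3]
      push_cast [List.length_cons]
      ring

end LeavittPath

/-! ### Necessity of the two conditions -/

open LeavittPath DirectedGraph LeavittPathAlgebra

/-- The kernel congruence cannot be universal, since it does not relate `x` to 0; so it is the
diagonal. -/
theorem IsCongruenceSimple.injective_of_ne_zero {R A : Type*} [NonUnitalSemiring R]
    [NonUnitalSemiring A] (hR : IsCongruenceSimple R) (φ : R →ₙ+* A) {x : R} (hx : φ x ≠ 0) :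
    Function.Injective φ := by
  rcases hR (RingCon.comap ⊥ φ) with h | h
  · intro a b hab
    have : RingCon.comap ⊥ φ a b := hab
    rwa [h] at this
  · have : RingCon.comap ⊥ φ x 0 := by rw [h]; trivial
    exact absurd (this.trans (map_zero φ)) hx

namespace LeavittPathAlgebra

variable {V E : Type*} {Γ : DirectedGraph V E}

theorem eq_empty_or_univ_of_isCongruenceSimple (hΓ : Γ.RowFinite)
    (h : IsCongruenceSimple (LeavittPathAlgebra BooleanSemifield Γ)) {H : Set V}
    (hH : Γ.IsHereditary H) (hS : Γ.IsSaturated H) : H = ∅ ∨ H = Set.univ := by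
  by_contra! hne
  obtain ⟨⟨v, hv⟩, hu⟩ := hne
  obtain ⟨w, hw⟩ := (Set.ne_univ_iff_exists_notMem H).1 hu
  have h0 : Γ.IsHereditary ∅ := fun e he => he
  have s0 : Γ.IsSaturated ∅ := fun v hv h => by
    obtain ⟨e, he⟩ := hv.1
    exact h e he
  obtain ⟨f, hf, -⟩ := exists_isBranching hΓ hS 0
  obtain ⟨g, hg, -⟩ := exists_isBranching hΓ s0 0
  obtain ⟨φ, hφ, -⟩ := exists_hom (S := BooleanSemifield) (relFamily hH hf)
  obtain ⟨ψ, hψ, -⟩ := exists_hom (S := BooleanSemifield) (relFamily h0 hg)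
  have hinj : Function.Injective φ := h.injective_of_ne_zero φ
    (x := (family BooleanSemifield Γ).vtx w) (by rw [hφ]; exact relFamily_vtx_ne_zero hH hf hw)
  have hv0 : (family BooleanSemifield Γ).vtx v = 0 :=
    hinj (by rw [hφ, map_zero]; exact relFamily_vtx_eq_zero hH hf hv)
  exact relFamily_vtx_ne_zero h0 hg (v := v) (by simp) (by rw [← hψ, hv0, map_zero])

theorem exists_isExit_of_isCongruenceSimple (hΓ : Γ.RowFinite)
    (h : IsCongruenceSimple (LeavittPathAlgebra BooleanSemifield Γ)) {p : List E}
    (hp : Γ.IsCycle p) : ∃ f : E, Γ.IsExit f p := by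
  by_contra! hne
  have hsole : ∀ e ∈ p, Γ.IsSoleEdge e := fun e he e' hs =>
    by_contra fun hee => hne e' ⟨e, he, hs, hee⟩
  have hw := hp.isWalk
  set v := Γ.s (p.head hp.ne_nil)
  have h0 : Γ.IsHereditary ∅ := fun e he => he
  have s0 : Γ.IsSaturated ∅ := fun v hv h => by
    obtain ⟨e, he⟩ := hv.1
    exact h e he
  obtain ⟨f, hf, hk⟩ := exists_isBranching hΓ s0 0
  obtain ⟨g, hg, hl⟩ := exists_isBranching hΓ s0 1
  obtain ⟨φ, hφ, hφe⟩ := exists_hom (S := BooleanSemifield) (relFamily h0 hf)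
  obtain ⟨ψ, hψ, hψe⟩ := exists_hom (S := BooleanSemifield) (relFamily h0 hg)
  have hinj : Function.Injective φ := h.injective_of_ne_zero φ
    (x := (family BooleanSemifield Γ).vtx v)
    (by rw [hφ]; exact relFamily_vtx_ne_zero h0 hf (by simp))
  -- With shift 0 the cycle acts as the identity on the copy of `ℤ` at `v`, just as `v` does.
  have hpv : (family BooleanSemifield Γ).real v p = (family BooleanSemifield Γ).vtx v := by
    apply hinj
    rw [Family.map_real φ hφ hφe, hφ]
    ext x y
    rw [relFamily_real h0 hf hk hw hsole,
      ← Family.real_nil, relFamily_real h0 hf hk (isWalk_nil.2 rfl) (by simp)]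
    simp
  have hpv' := congrArg ψ hpv
  rw [Family.map_real ψ hψ hψe, hψ] at hpv'
  -- With shift 1 the cycle moves points by its positive length, so it cannot fix `(v, 0)`.
  have := (relFamily_real h0 hg hl hw hsole (v, (0 : ℤ)) (v, (0 : ℤ))).1
    (by rw [hpv']; exact ⟨rfl, rfl, by simp⟩)
  have hlen := List.length_pos_iff.2 hp.ne_nil
  have := this.2.2
  simp only [zero_add, one_mul] at this
  omega

end LeavittPathAlgebra

/-! ### Sufficiency: absorption, compression and annihilation -/

namespace RingCon

variable {A : Type*} [NonUnitalSemiring A] (ρ : RingCon A)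

/-- If `b` can be absorbed into `a` modulo `ρ`, though not in `A`, then this holds for one of the
summands of `b`. -/
theorem exists_summand (hA : ∀ a : A, a + a = a) {M : Set A} {a b : A}
    (hb : b ∈ AddSubmonoid.closure M) (hab : ρ a (a + b)) (hne : a + b ≠ a) :
    ∃ m ∈ M, ρ a (a + m) ∧ a + m ≠ a := by
  induction hb using AddSubmonoid.closure_induction with
  | mem x hx => exact ⟨x, hx, hab, hne⟩
  | zero => exact absurd (add_zero a) hne
  | add x y _ _ ihx ihy =>
    by_cases hx : a + x = a
    · rw [← add_assoc, hx] at hab hne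
      exact ihy hab hne
    · refine ihx ?_ hx
      have h := ρ.add (ρ.symm hab) (ρ.refl x)
      -- Adding `x` to both sides leaves `a + (x + y)` unchanged, which makes it congruent to `a +
      -- x`.
      have hxx : a + (x + y) + x = a + (x + y) := by
        rw [add_assoc, add_comm (x + y), ← add_assoc x, hA]
      rw [hxx] at h
      exact ρ.trans hab h

end RingCon

namespace LeavittPath.Family

open DirectedGraph

variable {V E : Type*} {Γ : DirectedGraph V E} {A : Type*} [NonUnitalSemiring A]
  {F : Family Γ A}

/-- A vertex keeps or kills each monomial, so multiplying by it only drops summands. -/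
theorem vtx_mul_le (hA : ∀ a : A, a + a = a) (hF : AddSubmonoid.closure F.monomials = ⊤)
    (v : V) (a : A) : a + F.vtx v * a = a := by
  have ha : a ∈ AddSubmonoid.closure F.monomials := hF ▸ AddSubmonoid.mem_top a
  induction ha using AddSubmonoid.closure_induction with
  | mem x hx =>
    rcases vtx_mul_monomial hx v with h | h <;> rw [h]
    exacts [add_zero x, hA x]
  | zero => rw [mul_zero, add_zero]
  | add x y _ _ hx hy => rw [mul_add, add_add_add_comm, hx, hy]

theorem mul_vtx_le (hA : ∀ a : A, a + a = a) (hF : AddSubmonoid.closure F.monomials = ⊤)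
    (v : V) (a : A) : a + a * F.vtx v = a := by
  have ha : a ∈ AddSubmonoid.closure F.monomials := hF ▸ AddSubmonoid.mem_top a
  induction ha using AddSubmonoid.closure_induction with
  | mem x hx =>
    rcases monomial_mul_vtx hx v with h | h <;> rw [h]
    exacts [add_zero x, hA x]
  | zero => rw [zero_mul, add_zero]
  | add x y _ _ hx hy => rw [add_mul, add_add_add_comm, hx, hy]

theorem edg_mul_gho_le (hA : ∀ a : A, a + a = a) (hΓ : Γ.RowFinite) (e : E) :
    F.vtx (Γ.s e) + F.edg e * F.gho e = F.vtx (Γ.s e) := by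
  classical
  rw [F.regular (Γ.s e) ⟨⟨e, rfl⟩, hΓ _⟩]
  have he : e ∈ (hΓ (Γ.s e)).toFinset := by simp
  rw [← Finset.sum_erase_add _ _ he, add_assoc, hA]

/-- Conjugating the bound for the tail by the first edge `e` gives a bound by `e e*`, itself a
summand of the source vertex. -/
theorem real_mul_ghost_le (hA : ∀ a : A, a + a = a) (hΓ : Γ.RowFinite) {v w : V} {p : List E}
    (hp : Γ.IsWalk v p w) : F.vtx v + F.real v p * F.ghost v p = F.vtx v := by
  induction p generalizing v with
  | nil => rw [real_nil, ghost_nil, F.vertex_idem, hA]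
  | cons e p ih =>
    obtain ⟨rfl, hp⟩ := hp
    have h : F.real (Γ.s e) (e :: p) * F.ghost (Γ.s e) (e :: p) =
        F.edg e * (F.real (Γ.r e) p * F.ghost (Γ.r e) p) * F.gho e := by
      simp only [real_cons, ghost_cons, mul_assoc]
    have h' : F.edg e * F.gho e =
        F.edg e * F.gho e + F.edg e * (F.real (Γ.r e) p * F.ghost (Γ.r e) p) * F.gho e := by
      conv_lhs => rw [← F.edge_range, ← ih hp, mul_add, add_mul, F.edge_range]
    rw [h, ← edg_mul_gho_le hA hΓ e, add_assoc, ← h']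

/-- Absorption of `p q*` into `a` is detected by absorption of the common target into `p* a q`. -/
theorem add_real_mul_ghost (hA : ∀ a : A, a + a = a) (hΓ : Γ.RowFinite)
    (hF : AddSubmonoid.closure F.monomials = ⊤) {u v w : V} {p q : List E}
    (hp : Γ.IsWalk u p w) (hq : Γ.IsWalk v q w) {a : A}
    (h : F.ghost u p * a * F.real v q + F.vtx w = F.ghost u p * a * F.real v q) :
    a + F.real u p * F.ghost v q = a := by
  have hleft (a : A) : a + F.real u p * F.ghost u p * a = a := by
    conv_rhs => rw [← vtx_mul_le hA hF u a, ← real_mul_ghost_le hA hΓ hp, add_mul, ← add_assoc,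
      vtx_mul_le hA hF]
  have hright (a : A) : a + a * (F.real v q * F.ghost v q) = a := by
    conv_rhs => rw [← mul_vtx_le hA hF v a, ← real_mul_ghost_le hA hΓ hq, mul_add, ← add_assoc,
      mul_vtx_le hA hF]
  have h1 : a + F.real u p * (F.ghost u p * a * F.real v q) * F.ghost v q = a := by
    have : F.real u p * (F.ghost u p * a * F.real v q) * F.ghost v q =
        F.real u p * F.ghost u p * a * (F.real v q * F.ghost v q) := by
      simp only [mul_assoc]
    rw [this]
    conv_lhs => rw [← hleft a, add_assoc, hleft a, hright]
    exact hleft a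
  have h2 : F.real u p * (F.ghost u p * a * F.real v q) * F.ghost v q + F.real u p * F.ghost v q =
      F.real u p * (F.ghost u p * a * F.real v q) * F.ghost v q := by
    conv_rhs => rw [← h, mul_add, add_mul, real_mul_vtx hp]
  rw [← h1, add_assoc, h2]

/-- If a vertex can be absorbed into `a` modulo `ρ`, though not in `A`, then so can `p p*` for some
path `p` of length `n`, or for a shorter one that ends in a sink. -/
theorem exists_walk (hA : ∀ a : A, a + a = a) (hΓ : Γ.RowFinite) (ρ : RingCon A) {a : A} {v : V}
    (hρ : ρ a (a + F.vtx v)) (hne : a + F.vtx v ≠ a) (n : ℕ) :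
    ∃ (p : List E) (w : V), Γ.IsWalk v p w ∧ (n ≤ p.length ∨ ∀ e, Γ.s e ≠ w) ∧
      ρ a (a + F.real v p * F.ghost v p) ∧ a + F.real v p * F.ghost v p ≠ a := by
  induction n with
  | zero => exact ⟨[], v, rfl, .inl le_rfl, by simpa [F.vertex_idem], by simpa [F.vertex_idem]⟩
  | succ n ih =>
    obtain ⟨p, w, hp, hw, hρ, hne⟩ := ih
    by_cases hs : ∀ e, Γ.s e ≠ w
    · exact ⟨p, w, hp, .inr hs, hρ, hne⟩
    have hn : n ≤ p.length := hw.resolve_right hs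
    push Not at hs
    obtain ⟨e, he⟩ := hs
    have hreg : Γ.IsRegular w := ⟨⟨e, he⟩, hΓ w⟩
    -- Inserting the regular relation at `w` splits `p p*` into the terms `(pe)(pe)*`; one of them
    -- inherits the absorption property.
    have hsum : F.real v p * F.ghost v p ∈ AddSubmonoid.closure
        {m | ∃ e, Γ.s e = w ∧ m = F.real v (p ++ [e]) * F.ghost v (p ++ [e])} := by
      rw [← real_mul_vtx hp, F.regular w hreg, Finset.mul_sum, Finset.sum_mul]
      refine sum_mem fun e he => AddSubmonoid.subset_closure ?_
      have he : Γ.s e = w := by simpa using he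
      have hwe : Γ.IsWalk w [e] (Γ.r e) := ⟨he, rfl⟩
      refine ⟨e, he, ?_⟩
      rw [real_append hp hwe, ghost_append hp hwe]
      simp [mul_assoc, F.edge_range, F.range_ghost]
    obtain ⟨_, ⟨e, he, rfl⟩, h1, h2⟩ := ρ.exists_summand hA hsum hρ hne
    exact ⟨p ++ [e], Γ.r e, hp.append ⟨he, rfl⟩, .inl (by simpa using hn), h1, h2⟩

variable (F) in
/-- The closed paths and closed ghost paths of positive length at `w`. -/
def closedMonomials (w : V) : Set A :=
  {m | ∃ c : List E, Γ.IsWalk w c w ∧ c ≠ [] ∧ (m = F.real w c ∨ m = F.ghost w c)}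

theorem ghost_mul_real_mem {v w : V} {p q : List E} (hp : Γ.IsWalk v p w) (hq : Γ.IsWalk v q w) :
    F.ghost v p * F.real v q ∈
      AddSubmonoid.closure (insert (F.vtx w) (F.closedMonomials w)) := by
  rcases ghost_mul_real_cases (F := F) hp hq with h | ⟨c, -, hc, h⟩ | ⟨c, -, hc, h⟩ <;> rw [h]
  · exact zero_mem _
  all_goals
    refine AddSubmonoid.subset_closure ?_
    by_cases hne : c = []
    · subst hne; exact .inl rfl
    · exact .inr ⟨c, hc, hne, by simp⟩

/-- Compression by a path that is long enough turns an element into a sum of closed paths and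
closed ghost paths. -/
theorem exists_compression_mem (hF : AddSubmonoid.closure F.monomials = ⊤) (a : A) :
    ∃ n : ℕ, ∀ (v w : V) (p : List E), Γ.IsWalk v p w → (n ≤ p.length ∨ ∀ e, Γ.s e ≠ w) →
      F.ghost v p * a * F.real v p ∈
        AddSubmonoid.closure (insert (F.vtx w) (F.closedMonomials w)) := by
  have ha : a ∈ AddSubmonoid.closure F.monomials := hF ▸ AddSubmonoid.mem_top a
  induction ha using AddSubmonoid.closure_induction with
  | zero => exact ⟨0, fun v w p _ _ => by rw [mul_zero, zero_mul]; exact zero_mem _⟩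
  | add x y _ _ hx hy =>
    obtain ⟨n, hn⟩ := hx
    obtain ⟨m, hm⟩ := hy
    refine ⟨max n m, fun v w p hp h => ?_⟩
    rw [mul_add, add_mul]
    exact add_mem (hn v w p hp (h.imp_left (le_max_left n m).trans))
      (hm v w p hp (h.imp_left (le_max_right n m).trans))
  | mem x hx =>
    obtain ⟨x, y, z, q, t, hq, ht, rfl⟩ := hx
    refine ⟨max q.length t.length, fun v w p hp h => ?_⟩
    -- Neither path of the monomial can properly extend `p`: `p` is at least as long, or ends where
    -- no edge starts.
    have hnil {z w : V} {p q r : List E} (hpq : q = p ++ r) (hr : Γ.IsWalk w r z)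
        (h : q.length ≤ p.length ∨ ∀ e, Γ.s e ≠ w) : r = [] := by
      rcases h with h | h
      · rw [hpq, List.length_append] at h
        exact List.length_eq_zero_iff.1 (by omega)
      · cases r with
        | nil => rfl
        | cons e r => exact absurd hr.1 (h e)
    have h1 : F.ghost v p * F.real x q = 0 ∨
        ∃ r, Γ.IsWalk z r w ∧ F.ghost v p * F.real x q = F.ghost z r := by
      rcases ghost_mul_real_cases (F := F) hp hq with h' | ⟨r, -, hr, h'⟩ | ⟨r, hpq, hr, h'⟩
      · exact .inl h'
      · exact .inr ⟨r, hr, h'⟩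
      · obtain rfl := hnil hpq hr (h.imp_left (le_max_left _ _).trans)
        obtain rfl := isWalk_nil.1 hr
        exact .inr ⟨[], rfl, h'⟩
    have h2 : F.ghost y t * F.real v p = 0 ∨
        ∃ r, Γ.IsWalk z r w ∧ F.ghost y t * F.real v p = F.real z r := by
      rcases ghost_mul_real_cases (F := F) ht hp with h' | ⟨r, hpq, hr, h'⟩ | ⟨r, -, hr, h'⟩
      · exact .inl h'
      · obtain rfl := hnil hpq hr (h.imp_left (le_max_right _ _).trans)
        obtain rfl := isWalk_nil.1 hr
        exact .inr ⟨[], rfl, h'⟩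
      · exact .inr ⟨r, hr, h'⟩
    have h3 : F.ghost v p * (F.real x q * F.ghost y t) * F.real v p =
        (F.ghost v p * F.real x q) * (F.ghost y t * F.real v p) := by simp only [mul_assoc]
    rw [h3]
    rcases h1 with h1 | ⟨r, hr, h1⟩
    · rw [h1, zero_mul]; exact zero_mem _
    rcases h2 with h2 | ⟨r', hr', h2⟩
    · rw [h2, mul_zero]; exact zero_mem _
    rw [h1, h2]
    exact ghost_mul_real_mem hr hr'

/-- By idempotence, a sum with `m` among its summands would absorb `m`. -/
theorem _root_.AddSubmonoid.mem_closure_of_mem_closure_insert {M : Set A}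
    {a m : A} (hm : m + m = m) (ha : a ∈ AddSubmonoid.closure (insert m M)) (hne : a + m ≠ a) :
    a ∈ AddSubmonoid.closure M := by
  induction ha using AddSubmonoid.closure_induction with
  | mem x hx =>
    rcases hx with rfl | hx
    · exact absurd hm hne
    · exact AddSubmonoid.subset_closure hx
  | zero => exact zero_mem _
  | add x y _ _ hx hy =>
    refine add_mem (hx fun h => hne ?_) (hy fun h => hne ?_)
    · rw [add_right_comm, h]
    · rw [add_assoc, h]

theorem ghost_mul_real_eq_zero {u v w z : V} {p q : List E} (hp : Γ.IsWalk u p v)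
    (hq : Γ.IsWalk w q z) (hpq : ¬ p <+: q) (hqp : ¬ q <+: p) :
    F.ghost u p * F.real w q = 0 := by
  rcases ghost_mul_real_cases (F := F) hp hq with h | ⟨r, h, -⟩ | ⟨r, h, -⟩
  · exact h
  · exact absurd ⟨r, h.symm⟩ hqp
  · exact absurd ⟨r, h.symm⟩ hpq

/-- If each cycle has an exit, then a sum of closed paths and closed ghost paths of positive length
is annihilated by the compression by some path. -/
theorem exists_compression_eq_zero (hΓ : ∀ p : List E, Γ.IsCycle p → ∃ f : E, Γ.IsExit f p)
    {w : V} {a : A} (ha : a ∈ AddSubmonoid.closure (F.closedMonomials w)) {t : List E} {u : V}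
    (ht : Γ.IsWalk w t u) :
    ∃ (q : List E) (u' : V), Γ.IsWalk u q u' ∧
      F.ghost w (t ++ q) * a * F.real w (t ++ q) = 0 := by
  induction ha using AddSubmonoid.closure_induction generalizing t u with
  | mem x hx =>
    obtain ⟨c, hc, hne, hx⟩ := hx
    -- Compressing `c` or `c*` by `t ++ q` compares `t ++ q` with `c ++ (t ++ q)`; if neither is a
    -- prefix of the other, the result is 0.
    obtain ⟨q, u', hq, hpre⟩ := hc.exists_extension (hc.exists_isExit hΓ hne) ht
    have htq := ht.append hq
    have hpre' : ¬ c ++ (t ++ q) <+: t ++ q := fun h => by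
      have h := h.length_le
      rw [List.length_append (as := c)] at h
      exact hne (List.length_eq_zero_iff.1 (by omega))
    refine ⟨q, u', hq, ?_⟩
    rcases hx with rfl | rfl
    · rw [mul_assoc, ← real_append hc htq]
      exact ghost_mul_real_eq_zero htq (hc.append htq) hpre hpre'
    · rw [← ghost_append hc htq]
      exact ghost_mul_real_eq_zero (hc.append htq) htq hpre' hpre
  | zero => exact ⟨[], u, rfl, by rw [mul_zero, zero_mul]⟩
  | add x y _ _ hx hy =>
    obtain ⟨q, u₁, hq, hx⟩ := hx ht
    -- The path for `y` extends the one that kills `x`, and further compression keeps `x` at 0.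
    obtain ⟨q', u₂, hq', hy⟩ := hy (ht.append hq)
    refine ⟨q ++ q', u₂, hq.append hq', ?_⟩
    rw [← List.append_assoc, mul_add, add_mul, hy, add_zero, real_append (ht.append hq) hq',
      ghost_append (ht.append hq) hq']
    have h : F.ghost u₁ q' * F.ghost w (t ++ q) * x * (F.real w (t ++ q) * F.real u₁ q') =
        F.ghost u₁ q' * (F.ghost w (t ++ q) * x * F.real w (t ++ q)) * F.real u₁ q' := by
      simp only [mul_assoc]
    rw [h, hx, mul_zero, zero_mul]

theorem rel_compression {u v w : V} {p q : List E} (hp : Γ.IsWalk u p w) (hq : Γ.IsWalk v q w)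
    {ρ : RingCon A} {a : A} (h : ρ a (a + F.real u p * F.ghost v q)) :
    ρ (F.ghost u p * a * F.real v q) (F.ghost u p * a * F.real v q + F.vtx w) := by
  have h1 := ρ.mul (ρ.mul (ρ.refl (F.ghost u p)) h) (ρ.refl (F.real v q))
  have h2 : F.ghost u p * (F.real u p * F.ghost v q) * F.real v q = F.vtx w := by
    rw [← mul_assoc, ghost_mul_real_self hp, mul_assoc, ghost_mul_real_self hq, F.vertex_idem]
  rwa [mul_add, add_mul, h2] at h1

/-- If each cycle has an exit, then each congruence other than the diagonal one annihilates some
vertex. -/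
theorem exists_rel_vtx_zero (hA : ∀ a : A, a + a = a) (hΓ : Γ.RowFinite)
    (hcyc : ∀ p : List E, Γ.IsCycle p → ∃ f : E, Γ.IsExit f p)
    (hF : AddSubmonoid.closure F.monomials = ⊤) {ρ : RingCon A} (hρ : ρ ≠ ⊥) :
    ∃ v, ρ (F.vtx v) 0 := by
  -- If every absorption modulo `ρ` were genuine, congruent elements would absorb each other and
  -- hence coincide.
  obtain ⟨a, b, hab, hne⟩ : ∃ a b, ρ a (a + b) ∧ a + b ≠ a := by
    by_contra! hcon
    refine hρ (RingCon.ext fun a b => ⟨fun h => ?_, fun h => ?_⟩)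
    · have h1 := ρ.add (ρ.refl a) h
      have h2 := ρ.add h (ρ.refl b)
      rw [hA] at h1 h2
      have h3 := hcon a b h1
      have h4 := hcon b a (by rw [add_comm b a]; exact ρ.symm h2)
      exact h3.symm.trans ((add_comm a b).trans h4)
    · obtain rfl : a = b := h
      exact ρ.refl a
  obtain ⟨_, ⟨u, v, w, p, q, hp, hq, rfl⟩, hab, hne⟩ :=
    ρ.exists_summand hA (hF ▸ AddSubmonoid.mem_top b) hab hne
  have hne := mt (add_real_mul_ghost hA hΓ hF hp hq) hne
  have hab := rel_compression hp hq hab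
  obtain ⟨n, hn⟩ := exists_compression_mem hF (F.ghost u p * a * F.real v q)
  obtain ⟨r, x, hr, hrn, hab, hne⟩ := exists_walk hA hΓ ρ hab hne n
  have hne := mt (add_real_mul_ghost hA hΓ hF hr hr) hne
  have hab := rel_compression hr hr hab
  have hmem := AddSubmonoid.mem_closure_of_mem_closure_insert (hA _) (hn w x r hr hrn) hne
  obtain ⟨t, y, ht, h0⟩ := exists_compression_eq_zero hcyc hmem (isWalk_nil.2 (Eq.refl x))
  rw [List.nil_append] at h0
  have h1 := ρ.mul (ρ.mul (ρ.refl (F.ghost x t)) hab) (ρ.refl (F.real x t))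
  rw [mul_add, add_mul, h0, zero_add, ghost_mul_vtx ht, ghost_mul_real_self ht] at h1
  exact ⟨y, ρ.symm h1⟩

/-- A congruence that annihilates a vertex is universal if there are no proper nonempty hereditary
and saturated sets of vertices. -/
theorem eq_top_of_rel_vtx_zero
    (hΓ : ∀ H : Set V, Γ.IsHereditary H → Γ.IsSaturated H → H = ∅ ∨ H = Set.univ)
    (hF : AddSubmonoid.closure F.monomials = ⊤) {ρ : RingCon A} {v : V}
    (hv : ρ (F.vtx v) 0) : ρ = ⊤ := by
  have hmul {x : A} (a b : A) (hx : ρ x 0) : ρ (a * x * b) 0 := by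
    simpa using ρ.mul (ρ.mul (ρ.refl a) hx) (ρ.refl b)
  have huniv : {v | ρ (F.vtx v) 0} = Set.univ := by
    refine (hΓ {v | ρ (F.vtx v) 0} (fun e he => ?_) fun w hw h => ?_).resolve_left
      (Set.nonempty_iff_ne_empty.1 ⟨v, hv⟩)
    -- Heredity comes from `e* s(e) e = r(e)`, saturation from `e r(e) e* = e e*` summed over the
    -- edges at a regular vertex.
    · have := hmul (F.gho e) (F.edg e) he
      rwa [F.ghost_source, F.ghost_edge_self] at this
    · change ρ (F.vtx w) 0
      rw [F.regular w hw]
      refine Finset.sum_induction _ (fun x => ρ x 0) (fun x y hx hy => ?_) (ρ.refl 0)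
        fun e he => ?_
      · simpa using ρ.add hx hy
      · have := hmul (F.edg e) (F.gho e) (h e (by simpa using he))
        rwa [F.edge_range] at this
  have hzero (a : A) : ρ a 0 := by
    have ha : a ∈ AddSubmonoid.closure F.monomials := hF ▸ AddSubmonoid.mem_top a
    induction ha using AddSubmonoid.closure_induction with
    | mem x hx =>
      obtain ⟨u, v, w, p, q, hp, hq, rfl⟩ := hx
      have hw : ρ (F.vtx w) 0 := (Set.ext_iff.1 huniv w).2 trivial
      have := hmul (F.real u p) (F.ghost v q) hw
      rwa [real_mul_vtx hp] at this
    | zero => exact ρ.refl 0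
    | add x y _ _ hx hy => simpa using ρ.add hx hy
  exact RingCon.ext fun a b => iff_of_true (ρ.trans (hzero a) (ρ.symm (hzero b))) trivial

end LeavittPath.Family


theorem theorem4p4 {V E : Type*} (Γ : DirectedGraph V E) (hΓ : Γ.RowFinite) :
    IsCongruenceSimple (LeavittPathAlgebra BooleanSemifield Γ) ↔
      (∀ H : Set V, Γ.IsHereditary H → Γ.IsSaturated H → H = ∅ ∨ H = Set.univ) ∧
      (∀ p : List E, Γ.IsCycle p → ∃ f : E, Γ.IsExit f p) := by
  refine ⟨fun h => ⟨fun H hH hS =>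
    LeavittPathAlgebra.eq_empty_or_univ_of_isCongruenceSimple hΓ h hH hS, fun p hp =>
    LeavittPathAlgebra.exists_isExit_of_isCongruenceSimple hΓ h hp⟩, ?_⟩
  rintro ⟨hH, hcyc⟩ ρ
  refine or_iff_not_imp_left.2 fun hρ => ?_
  have hF := LeavittPathAlgebra.closure_monomials Γ
  obtain ⟨v, hv⟩ := LeavittPath.Family.exists_rel_vtx_zero (LeavittPathAlgebra.add_self Γ) hΓ hcyc
    hF hρ
  exact LeavittPath.Family.eq_top_of_rel_vtx_zero hH hF hv
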